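/- For $0\le k\le n$ let $|S_{n,k}\rangle=\binom nk^{-1/2}\sum_{x\in\{0,1\}^n,\ |x|=k}|x\rangle$ be the $n$-qubit Dicke state with $k$ excitations, and for fixed $k$ let $\Psi_{S_k}=\{|S_{n,k}\rangle\}_{n\ge k}$. For a normalized $n$-qubit vector let $E_G(|\psi\rangle)=1-\max_\lambda|\langle\lambda|\psi\rangle|^2$, the maximum being over all normalized product vectors $|\lambda\rangle=\bigotimes_{i=1}^n|a_i\rangle$, and for a family $\Psi$ of states let $E_G(\Psi)=\sup_{|\psi\rangle\in\Psi}E_G(|\psi\rangle)$. Let $F(\rho,\sigma)=\bigl(\operatorname{tr}\sqrt{\sqrt\rho\,\sigma\sqrt\rho}\bigr)^2$ be the fidelity. Let $D$ be a real-valued function of pairs of $n$-qubit states, for every $n$ (for instance a distance; no metric axioms are needed), that is strictly related to the fidelity: there are $\varepsilon_0\in\mathbb R$ and a function $\eta$ that is strictly increasing on $[0,\varepsilon_0]$, with $0\le\eta\le1$ there and $\eta(0)=0$, such that for all $\varepsilon\in[0,\varepsilon_0]$ and all $n$-qubit states $\rho,\sigma$, $D(\rho,\sigma)\le\varepsilon$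 implies $F(\rho,\sigma)\ge1-\eta(\varepsilon)$. A family $\Psi$ of pure multi-qubit states is an $\varepsilon$-approximate universal deterministic MBQC resource (with respect to $D$) if for every $m$ and every normalized $m$-qubit vector $|\chi\rangle$ there are an $n$-qubit member $|\psi\rangle\in\Psi$ with $n\ge m$, a choice of $m$ of the $n$ qubits, and a deterministic LOCC operation $\Lambda$ among the $n$ qubits (finitely many rounds; in each round one party applies a generalized measurement with finitely many outcomes to its qubit and broadcasts the outcome, on which all later steps may depend) such that $D\bigl(\Lambda(|\psi\rangle\langle\psi|),\,|\chi\rangle\langle\chi|\otimes|0\rangle\langle0|^{\otimes(n-m)}\bigr)\le\varepsilon$, with $|\chi\rangle$ on the chosen qubits. Then for every fixed integer $k\ge1$ the following hold. 1. For all $D,\eta,\varepsilon_0$ as above and all $\varepsilon\in[0,\varepsilon_0]$ with $\eta(\varepsilon)\le 0.001\,k^{-3/2}$, the family $\Psi_{S_k}$ is not an $\varepsilon$-approximate universal deterministic MBQC resource. 2. The asymptotic geometric entanglement of the family stays below $1$: $$E_G(\Psi_{S_k})=\lim_{n\to\infty}E_G(|S_{n,k}\rangle)=1-\frac{k^k}{e^k\,k!}.$$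 3. For every real $\eta$ with $0\le\eta\le0.00099\,k^{-3/2}$, the inequality $E_G(\Psi_{S_k})>1-4\eta^{1/3}+3.4\,\eta^{2/3}$ does not hold. -/

import Mathlib

open Set Filter Topology
open scoped BigOperators Nat ComplexOrder MatrixOrder

noncomputable section

/-! ### Qubit states -/

/-- Computational basis labels of `n` qubits: bit strings of length `n`. -/
abbrev Bits (n : ℕ) : Type := Fin n → Fin 2

/-- The Hilbert space `(ℂ²)^{⊗ n}` of `n` qubits, in the computational basis. -/
abbrev QubitSpace (n : ℕ) : Type := EuclideanSpace ℂ (Bits n)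

/-- Operators on `n` qubits, as matrices in the computational basis. -/
abbrev QubitOp (n : ℕ) : Type := Matrix (Bits n) (Bits n) ℂ

/-- Density operators: positive semidefinite with unit trace. -/
def IsDensity {n : ℕ} (ρ : QubitOp n) : Prop :=
  ρ.PosSemidef ∧ ρ.trace = 1

/-- The rank-one operator `|ψ⟩⟨ψ|`. -/
def pureDensity {n : ℕ} (ψ : QubitSpace n) : QubitOp n :=
  Matrix.of fun x y => ψ x * star (ψ y)

/-- The product vector `a₁ ⊗ ⋯ ⊗ aₙ` of single-qubit vectors. -/
def productVec {n : ℕ} (a : Fin n → EuclideanSpace ℂ (Fin 2)) : QubitSpace n :=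
  WithLp.toLp 2 fun x => ∏ i, a i (x i)

/-- The normalized pure product states of `n` qubits. -/
def productStates (n : ℕ) : Set (QubitSpace n) :=
  {v | ∃ a : Fin n → EuclideanSpace ℂ (Fin 2), (∀ i, ‖a i‖ = 1) ∧ v = productVec a}

/-- Geometric measure of entanglement of a pure state, `1 - max_λ |⟨λ|ψ⟩|²` over the normalized
pure product states. -/
def geometricEntanglement {n : ℕ} (ψ : QubitSpace n) : ℝ :=
  1 - sSup ((fun v : QubitSpace n => ‖inner ℂ v ψ‖ ^ 2) '' productStates n)

/-- The fidelity `F(ρ, σ) = (tr √(√ρ σ √ρ))²`; for pure states it is `|⟨ψ|χ⟩|²`. -/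
def fidelity {n : ℕ} (ρ σ : QubitOp n) : ℝ :=
  (Matrix.trace (CFC.sqrt (CFC.sqrt ρ * σ * CFC.sqrt ρ))).re ^ 2

/-! ### LOCC -/

/-- The operator acting as the one-qubit operator `K` on qubit `i` and as the identity on all
the other qubits. -/
def localOp {n : ℕ} (i : Fin n) (K : Matrix (Fin 2) (Fin 2) ℂ) : QubitOp n :=
  Matrix.of fun x y => if ∀ j, j ≠ i → x j = y j then K (x i) (y i) else 0

/-- Deterministic (trace-preserving) `n`-party LOCC operations, one qubit per party: finite
adaptive protocols. Either terminate, or some party `i` performs a generalized measurement with Kraus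
operators `K 0, …, K (r-1)` on its qubit and broadcasts the outcome `x`, and the parties then
continue with a protocol `Λ x` that depends on `x`. Outcomes may be ignored, so this covers
arbitrary finite local instruments. -/
inductive IsLOCC {n : ℕ} : (QubitOp n → QubitOp n) → Prop
  | done : IsLOCC (fun ρ => ρ)
  | step (i : Fin n) (r : ℕ) (K : Fin r → Matrix (Fin 2) (Fin 2) ℂ)
      (hK : ∑ x, (K x).conjTranspose * K x = 1)
      (Λ : Fin r → QubitOp n → QubitOp n) (hΛ : ∀ x, IsLOCC (Λ x)) :
      IsLOCC (fun ρ => ∑ x, Λ x (localOp i (K x) * ρ * (localOp i (K x)).conjTranspose))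

/-! ### Approximate universality -/

/-- The `n`-qubit vector carrying the `m`-qubit vector `χ` on the qubits `f 0, …, f (m-1)`, with
all the other qubits in the state `|0⟩`. -/
def padZero {m n : ℕ} (f : Fin m ↪ Fin n) (χ : QubitSpace m) : QubitSpace n :=
  open Classical in
  WithLp.toLp 2 fun x => if ∀ j, j ∉ Set.range f → x j = 0 then χ (fun i => x (f i)) else 0

/-- `D` (a distance between states, for each number of qubits) is strictly related to the
fidelity through the function `η` on `[0, ε₀]`. -/
structure StrictlyRelatedToFidelity (D : ∀ n : ℕ, QubitOp n → QubitOp n → ℝ) (η : ℝ → ℝ)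
    (ε₀ : ℝ) : Prop where
  mem_unit : ∀ ε ∈ Icc 0 ε₀, η ε ∈ Icc (0 : ℝ) 1
  strictMono : StrictMonoOn η (Icc 0 ε₀)
  map_zero : η 0 = 0
  le_fidelity : ∀ ε ∈ Icc 0 ε₀, ∀ (n : ℕ) (ρ σ : QubitOp n), IsDensity ρ → IsDensity σ →
    D n ρ σ ≤ ε → 1 - η ε ≤ fidelity ρ σ

/-- A family `Ψ` of pure multi-qubit states is an `ε`-approximate universal (deterministic) MBQC
resource: every pure state `χ` of any number `m` of qubits can be prepared from some member of `Ψ`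
by deterministic LOCC, up to inaccuracy `ε` in the distance `D`. -/
def IsApproxUniversal (D : ∀ n : ℕ, QubitOp n → QubitOp n → ℝ) (ε : ℝ)
    (Ψ : Set (Σ n : ℕ, QubitSpace n)) : Prop :=
  ∀ (m : ℕ) (χ : QubitSpace m), ‖χ‖ = 1 →
    ∃ (n : ℕ) (ψ : QubitSpace n) (f : Fin m ↪ Fin n) (Λ : QubitOp n → QubitOp n),
      (⟨n, ψ⟩ : Σ n : ℕ, QubitSpace n) ∈ Ψ ∧ IsLOCC Λ ∧
        D n (Λ (pureDensity ψ)) (pureDensity (padZero f χ)) ≤ ε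

/-- The geometric entanglement of a family of states: the supremum over its members. -/
def familyEntanglement (Ψ : Set (Σ n : ℕ, QubitSpace n)) : ℝ :=
  sSup ((fun s : Σ n : ℕ, QubitSpace n => geometricEntanglement s.2) '' Ψ)

/-! ### Dicke states -/

/-- The Dicke state `|S_{n,k}⟩`, the normalized sum of all computational basis states of `n`
qubits with exactly `k` qubits in `|1⟩` (meant for `k ≤ n`). -/
def dicke (n k : ℕ) : QubitSpace n :=
  WithLp.toLp 2 fun x =>
    if (Finset.univ.filter fun i => x i = 1).card = k then
      (((Real.sqrt (n.choose k))⁻¹ : ℝ) : ℂ) else 0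

/-- The family `{|S_{n,k}⟩}_n`, `n ≥ k`. -/
def dickeFamily (k : ℕ) : Set (Σ n : ℕ, QubitSpace n) :=
  {s | ∃ n : ℕ, k ≤ n ∧ s = ⟨n, dicke n k⟩}

end

/-! Everything rests on one number, the largest squared overlap of a Dicke state with a product
state. It is the binomial probability of `k` successes in `n` trials at the success probability `k /
n` (`geometricEntanglement_dicke`): the triangle inequality makes the amplitudes nonnegative,
averaging angles makes all factors equal, and one parameter remains to be optimized. As `n` grows
this tends to the Poisson weight `poissonPeak k` (`tendsto_dickeOverlap`) and never falls below it
(`poissonPeak_le_dickeOverlap`), so the supremum and the limit of the entanglement agree. Stirling's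
formula with an explicit error, `le_poissonPeak`, then reduces the claim about `1 - 4η^(1/3) +
3.4η^(2/3)` to a polynomial inequality in `1/√k`.

For non-universality, deterministic LOCC turns a pure state into an ensemble whose average product
overlap is at least the initial one (`IsLOCC.exists_ensemble`). If the output has fidelity `F` with
a target whose product overlaps are at most `δ`, that average is at most `2δ + 2(1 - F)`
(`IsLOCC.overlap_le`). Balanced Dicke states are targets with `δ` arbitrarily small, while every
member of the family has overlap at least `poissonPeak k`. Hence universality would force
`poissonPeak k ≤ 2η`, which is far from true for the given `η`. -/

/-! ### Overlap of Dicke states with product states -/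

/-- The sum over all bit strings of weight `k` of the products of the entries `t i (x i)`. -/
noncomputable def weightSum {n : ℕ} (k : ℕ) (t : Fin n → Fin 2 → ℝ) : ℝ :=
  ∑ x : Bits n, if (Finset.univ.filter fun i => x i = 1).card = k then ∏ i, t i (x i) else 0

/-- The qubit amplitudes `(cos θ, sin θ)`. -/
noncomputable def angleVec (θ : ℝ) : Fin 2 → ℝ := ![Real.cos θ, Real.sin θ]

lemma angleVec_nonneg {θ : ℝ} (h : θ ∈ Icc 0 (Real.pi / 2)) (a : Fin 2) : 0 ≤ angleVec θ a := by
  have hpi := Real.pi_pos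
  fin_cases a
  · exact Real.cos_nonneg_of_mem_Icc ⟨by linarith [h.1], h.2⟩
  · exact Real.sin_nonneg_of_mem_Icc ⟨h.1, by linarith [h.2]⟩

/-- For `a ≠ b` both sides equal `sin (α + β)`. For `a = b`, with mean `μ` and half-difference `d`,
the cosine product is `cos² μ - sin² d`, and the sine product is `sin² μ - sin² d`. -/
lemma angleVec_add_le (α β : ℝ) (a b : Fin 2) :
    angleVec α a * angleVec β b + angleVec β a * angleVec α b ≤
      2 * (angleVec ((α + β) / 2) a * angleVec ((α + β) / 2) b) := by
  have hα : α = (α + β) / 2 + (α - β) / 2 := by ring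
  have hβ : β = (α + β) / 2 - (α - β) / 2 := by ring
  generalize (α + β) / 2 = μ at *
  generalize (α - β) / 2 = d at *
  subst hα hβ
  have h1 := Real.sin_sq_add_cos_sq μ
  have h2 := Real.sin_sq_add_cos_sq d
  fin_cases a <;> fin_cases b <;>
    simp only [angleVec, Real.cos_add, Real.cos_sub, Real.sin_add, Real.sin_sub, Fin.zero_eta,
      Fin.mk_one, Matrix.cons_val_zero, Matrix.cons_val_one]
  · nlinarith [sq_nonneg (Real.sin d), sq_nonneg (Real.sin μ * Real.sin d),
      sq_nonneg (Real.cos μ * Real.sin d)]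
  · exact le_of_eq (by linear_combination (2 * Real.sin μ * Real.cos μ) * h2)
  · exact le_of_eq (by linear_combination (2 * Real.sin μ * Real.cos μ) * h2)
  · nlinarith [sq_nonneg (Real.sin d), sq_nonneg (Real.sin μ * Real.sin d),
      sq_nonneg (Real.cos μ * Real.sin d)]

lemma weightSum_comp_perm {n : ℕ} (k : ℕ) (t : Fin n → Fin 2 → ℝ) (e : Equiv.Perm (Fin n)) :
    weightSum k (t ∘ e) = weightSum k t := by
  unfold weightSum
  refine Fintype.sum_equiv (Equiv.arrowCongr e (Equiv.refl _)) _ _ fun x => ?_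
  have h1 : (Finset.univ.filter fun i => x i = 1).card =
      (Finset.univ.filter fun i => (Equiv.arrowCongr e (Equiv.refl (Fin 2))) x i = 1).card := by
    refine Finset.card_equiv e fun i => ?_
    simp
  rw [h1]
  congr 1
  refine Fintype.prod_equiv e _ _ fun i => ?_
  simp

/-- Replacing two angles by their mean. -/
noncomputable def averagePair {n : ℕ} (θ : Fin n → ℝ) (i j : Fin n) : Fin n → ℝ :=
  fun l => if l = i ∨ l = j then (θ i + θ j) / 2 else θ l

/-- Swapping qubits `i` and `j` leaves the sum unchanged, so it may be symmetrized over the swap.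
Then `angleVec_add_le` applies term by term, since the remaining factors are nonnegative. -/
lemma weightSum_le_averagePair {n : ℕ} (k : ℕ) (θ : Fin n → ℝ)
    (hθ : ∀ i, θ i ∈ Icc 0 (Real.pi / 2)) {i j : Fin n} (hij : i ≠ j) :
    weightSum k (fun l => angleVec (θ l)) ≤ weightSum k (fun l => angleVec (averagePair θ i j l)) := by
  have hs := weightSum_comp_perm k (fun l => angleVec (θ l)) (Equiv.swap i j)
  have split : ∀ g : Fin n → ℝ, ∏ l, g l = g i * g j * ∏ l ∈ (Finset.univ.erase i).erase j, g l := by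
    intro g
    rw [← Finset.mul_prod_erase _ _ (Finset.mem_univ i),
      ← Finset.mul_prod_erase _ _ (Finset.mem_erase.2 ⟨hij.symm, Finset.mem_univ j⟩), mul_assoc]
  suffices h : weightSum k (fun l => angleVec (θ l)) +
      weightSum k ((fun l => angleVec (θ l)) ∘ (Equiv.swap i j)) ≤
      2 * weightSum k (fun l => angleVec (averagePair θ i j l)) by linarith
  unfold weightSum
  rw [← Finset.sum_add_distrib, Finset.mul_sum]
  refine Finset.sum_le_sum fun x _ => ?_
  split_ifs
  swap
  · simp
  rw [split, split, split]
  have e1 : ∏ l ∈ (Finset.univ.erase i).erase j,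
      ((fun l => angleVec (θ l)) ∘ (Equiv.swap i j)) l (x l) =
      ∏ l ∈ (Finset.univ.erase i).erase j, angleVec (θ l) (x l) := by
    refine Finset.prod_congr rfl fun l hl => ?_
    simp only [Finset.mem_erase, Finset.mem_univ, and_true] at hl
    simp [Equiv.swap_apply_of_ne_of_ne hl.2 hl.1]
  have e2 : ∏ l ∈ (Finset.univ.erase i).erase j, angleVec (averagePair θ i j l) (x l) =
      ∏ l ∈ (Finset.univ.erase i).erase j, angleVec (θ l) (x l) := by
    refine Finset.prod_congr rfl fun l hl => ?_
    simp only [Finset.mem_erase, Finset.mem_univ, and_true] at hl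
    simp [averagePair, hl.1, hl.2]
  rw [e1, e2]
  have h0 : 0 ≤ ∏ l ∈ (Finset.univ.erase i).erase j, angleVec (θ l) (x l) :=
    Finset.prod_nonneg fun l _ => angleVec_nonneg (hθ l) _
  have := mul_le_mul_of_nonneg_right (angleVec_add_le (θ i) (θ j) (x i) (x j)) h0
  simp only [averagePair, Function.comp, Equiv.swap_apply_left, Equiv.swap_apply_right, true_or,
    or_true, if_true]
  linarith

lemma sum_sq_averagePair_lt {n : ℕ} (θ : Fin n → ℝ) {i j : Fin n} (h : θ i ≠ θ j) :
    ∑ l, averagePair θ i j l ^ 2 < ∑ l, θ l ^ 2 := by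
  have hij : i ≠ j := fun e => h (by rw [e])
  have split : ∀ g : Fin n → ℝ, ∑ l, g l = g i + g j + ∑ l ∈ (Finset.univ.erase i).erase j, g l := by
    intro g
    rw [← Finset.add_sum_erase _ _ (Finset.mem_univ i),
      ← Finset.add_sum_erase _ _ (Finset.mem_erase.2 ⟨hij.symm, Finset.mem_univ j⟩), add_assoc]
  rw [split, split (fun l => θ l ^ 2)]
  have e2 : ∑ l ∈ (Finset.univ.erase i).erase j, averagePair θ i j l ^ 2 =
      ∑ l ∈ (Finset.univ.erase i).erase j, θ l ^ 2 := by
    refine Finset.sum_congr rfl fun l hl => ?_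
    simp only [Finset.mem_erase, Finset.mem_univ, and_true] at hl
    simp [averagePair, hl.1, hl.2]
  rw [e2]
  simp only [averagePair, true_or, or_true, if_true]
  nlinarith [mul_self_pos.2 (sub_ne_zero.2 h)]

lemma continuous_weightSum_angleVec (n k : ℕ) :
    Continuous fun θ : Fin n → ℝ => weightSum k (fun l => angleVec (θ l)) := by
  have h : ∀ a : Fin 2, Continuous fun θ : ℝ => angleVec θ a := by
    intro a
    fin_cases a
    · exact Real.continuous_cos
    · exact Real.continuous_sin
  unfold weightSum
  refine continuous_finsetSum _ fun x _ => ?_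
  split_ifs
  · exact continuous_finsetProd _ fun i _ => (h (x i)).comp (continuous_apply i)
  · exact continuous_const

/-- Among the maximizers on the compact cube, take one with the least sum of squares. Averaging two
unequal angles would keep it a maximizer and lower the sum of squares, so all its angles agree. -/
lemma exists_weightSum_le_const {n : ℕ} (k : ℕ) (θ : Fin n → ℝ)
    (hθ : ∀ i, θ i ∈ Icc 0 (Real.pi / 2)) :
    ∃ μ ∈ Icc 0 (Real.pi / 2),
      weightSum k (fun l => angleVec (θ l)) ≤ weightSum k (fun _ : Fin n => angleVec μ) := by
  have hpi := Real.pi_pos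
  set K : Set (Fin n → ℝ) := Set.pi univ fun _ => Icc 0 (Real.pi / 2)
  have hK : IsCompact K := isCompact_univ_pi fun _ => isCompact_Icc
  have hc := continuous_weightSum_angleVec n k
  obtain ⟨τ, hτ, hmax⟩ := hK.exists_isMaxOn ⟨θ, fun i _ => hθ i⟩ hc.continuousOn
  have hK' : IsCompact (K ∩ {ω | weightSum k (fun l => angleVec (τ l)) ≤
      weightSum k (fun l => angleVec (ω l))}) :=
    hK.inter_right (isClosed_le continuous_const hc)
  obtain ⟨ω, hω, hmin⟩ := hK'.exists_isMinOn ⟨τ, hτ, le_refl (weightSum k fun l => angleVec (τ l))⟩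
    (f := fun ω : Fin n → ℝ => ∑ l, ω l ^ 2) (by fun_prop)
  have hωK : ∀ i, ω i ∈ Icc 0 (Real.pi / 2) := fun i => hω.1 i (mem_univ i)
  have hconst : ∀ i j, ω i = ω j := by
    intro i j
    by_contra h
    have hij : i ≠ j := fun e => h (by rw [e])
    refine (sum_sq_averagePair_lt ω h).not_ge (hmin ⟨fun l _ => ?_, ?_⟩)
    · unfold averagePair
      split_ifs
      · exact ⟨by linarith [(hωK i).1, (hωK j).1], by linarith [(hωK i).2, (hωK j).2]⟩
      · exact hωK l
    · exact le_trans hω.2 (weightSum_le_averagePair k ω hωK hij)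
  have hle : weightSum k (fun l => angleVec (θ l)) ≤ weightSum k (fun l => angleVec (ω l)) :=
    le_trans (hmax fun i _ => hθ i) hω.2
  rcases n with _ | n
  · refine ⟨0, ⟨le_rfl, by positivity⟩, hle.trans_eq ?_⟩
    congr 1
    exact Subsingleton.elim _ _
  · refine ⟨ω 0, hωK 0, hle.trans_eq ?_⟩
    congr 1
    funext l
    rw [hconst l 0]

lemma weightSum_const (n k : ℕ) (t : Fin 2 → ℝ) :
    weightSum k (fun _ : Fin n => t) = n.choose k * (t 1 ^ k * t 0 ^ (n - k)) := by
  have key : ∀ x : Bits n, ∏ i, t (x i) =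
      t 1 ^ (Finset.univ.filter fun i => x i = 1).card *
        t 0 ^ (n - (Finset.univ.filter fun i => x i = 1).card) := by
    intro x
    have : ∀ i, t (x i) = if x i = 1 then t 1 else t 0 := by
      intro i
      split_ifs with h
      · rw [h]
      · rw [show x i = 0 by omega]
    simp_rw [this]
    rw [Finset.prod_ite, Finset.prod_const, Finset.prod_const, Finset.filter_not,
      Finset.card_sdiff_of_subset (Finset.filter_subset _ _), Finset.card_univ, Fintype.card_fin]
  have hcard : (Finset.univ.filter fun x : Bits n =>
      (Finset.univ.filter fun i => x i = 1).card = k).card = n.choose k := by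
    have h := Finset.card_powersetCard k (Finset.univ : Finset (Fin n))
    rw [Finset.card_univ, Fintype.card_fin] at h
    rw [← h]
    refine Finset.card_bij' (fun x _ => Finset.univ.filter fun i => x i = 1)
      (fun S _ i => if i ∈ S then 1 else 0) ?_ ?_ ?_ ?_
    · intro x hx
      simpa [Finset.mem_powersetCard] using hx
    · intro S hS
      simpa [Finset.mem_powersetCard] using hS
    · intro x _
      funext i
      simp only [Finset.mem_filter, Finset.mem_univ, true_and]
      split_ifs with h
      · exact h.symm
      · omega
    · intro S _
      ext i
      simp
  unfold weightSum
  rw [← Finset.sum_filter, Finset.sum_congr rfl (g := fun _ => t 1 ^ k * t 0 ^ (n - k)),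
    Finset.sum_const, hcard, nsmul_eq_mul]
  intro x hx
  rw [key, (Finset.mem_filter.1 hx).2]

/-- The maximal squared overlap of the Dicke state `|S_{n,k}⟩` with a product state. -/
noncomputable def dickeOverlap (n k : ℕ) : ℝ :=
  n.choose k * ((k / n : ℝ) ^ k * (1 - k / n : ℝ) ^ (n - k))

/-- With `q = k / n`, weighted AM-GM gives `(p/q)^q * ((1-p)/(1-q))^(1-q) ≤ 1`; the `n`-th power is
the claim. The endpoints `k = 0` and `k = n` are separate because they make a denominator vanish. -/
lemma pow_mul_pow_le {n k : ℕ} (hkn : k ≤ n) (hn : 0 < n) {p : ℝ} (hp : p ∈ Icc (0 : ℝ) 1) :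
    p ^ k * (1 - p) ^ (n - k) ≤ (k / n : ℝ) ^ k * (1 - k / n : ℝ) ^ (n - k) := by
  have hn' : (0 : ℝ) < n := by exact_mod_cast hn
  rcases Nat.eq_zero_or_pos k with rfl | hk
  · have := hp.1
    have h2 := hp.2
    simpa using pow_le_one₀ (by linarith) (by linarith : 1 - p ≤ 1)
  rcases hkn.eq_or_lt with rfl | hlt
  · have : (k : ℝ) / k = 1 := div_self hn'.ne'
    simpa [this] using pow_le_one₀ hp.1 hp.2
  have hk' : (0 : ℝ) < k := by exact_mod_cast hk
  have hlt' : (k : ℝ) < n := by exact_mod_cast hlt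
  obtain ⟨q, hq⟩ : ∃ q : ℝ, q = k / n := ⟨_, rfl⟩
  rw [← hq]
  have hq0 : 0 < q := hq ▸ div_pos hk' hn'
  have hq1 : 0 < 1 - q := by
    rw [hq, sub_pos, div_lt_one hn']; exact hlt'
  have hsub : ((n - k : ℕ) : ℝ) = n * (1 - q) := by
    rw [Nat.cast_sub hkn, hq]; field_simp
  have hkq : (k : ℝ) = n * q := by rw [hq]; field_simp
  have h1p : 0 ≤ 1 - p := by linarith [hp.2]
  have amgm := Real.geom_mean_le_arith_mean2_weighted hq0.le hq1.le
    (div_nonneg hp.1 hq0.le) (div_nonneg h1p hq1.le) (by ring)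
  have e : q * (p / q) + (1 - q) * ((1 - p) / (1 - q)) = 1 := by field_simp; ring
  rw [e] at amgm
  have hpos := mul_nonneg (Real.rpow_nonneg (div_nonneg hp.1 hq0.le) q)
    (Real.rpow_nonneg (div_nonneg h1p hq1.le) (1 - q))
  have h2 := pow_le_one₀ (n := n) hpos amgm
  rw [mul_pow, ← Real.rpow_mul_natCast (div_nonneg hp.1 hq0.le),
    ← Real.rpow_mul_natCast (div_nonneg h1p hq1.le), mul_comm q, mul_comm (1 - q), ← hsub, ← hkq,
    Real.rpow_natCast, Real.rpow_natCast, div_pow, div_pow, div_mul_div_comm,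
    div_le_one (by positivity)] at h2
  exact h2

lemma norm_inner_dicke_sq {n k : ℕ} (hkn : k ≤ n) (hn : 0 < n)
    (a : Fin n → EuclideanSpace ℂ (Fin 2)) (ha : ∀ i, ‖a i‖ = 1) :
    ‖inner ℂ (productVec a) (dicke n k)‖ ^ 2 ≤ dickeOverlap n k := by
  have hC : (0 : ℝ) < n.choose k := by exact_mod_cast Nat.choose_pos hkn
  set θ : Fin n → ℝ := fun i => Real.arcsin ‖a i 1‖ with hθd
  have hsq : ∀ i, ‖a i 0‖ ^ 2 + ‖a i 1‖ ^ 2 = 1 := by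
    intro i
    have h := EuclideanSpace.norm_sq_eq (a i)
    rw [ha, Fin.sum_univ_two] at h
    linarith
  have hθ : ∀ i, θ i ∈ Icc 0 (Real.pi / 2) := fun i =>
    ⟨Real.arcsin_nonneg.2 (norm_nonneg _), Real.arcsin_le_pi_div_two _⟩
  have hang : ∀ i b, ‖a i b‖ = angleVec (θ i) b := by
    intro i b
    have h1 : ‖a i 1‖ ≤ 1 := by nlinarith [hsq i, sq_nonneg ‖a i 0‖, norm_nonneg (a i 1)]
    fin_cases b
    · change ‖a i 0‖ = Real.cos (Real.arcsin ‖a i 1‖)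
      rw [Real.cos_arcsin, ← hsq i, add_sub_cancel_right, Real.sqrt_sq (norm_nonneg _)]
    · exact (Real.sin_arcsin (by linarith [norm_nonneg (a i 1)]) h1).symm
  have hbound : ‖inner ℂ (productVec a) (dicke n k)‖ ≤
      (Real.sqrt (n.choose k))⁻¹ * weightSum k (fun l => angleVec (θ l)) := by
    rw [PiLp.inner_apply, weightSum, Finset.mul_sum]
    refine (norm_sum_le _ _).trans (Finset.sum_le_sum fun x _ => ?_)
    simp only [productVec, dicke, RCLike.inner_apply, norm_mul]
    split_ifs
    · simp only [map_prod, norm_prod, RCLike.norm_conj, hang, Complex.norm_real]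
      rw [Real.norm_of_nonneg (by positivity)]
    · simp
  obtain ⟨μ, hμ, hle⟩ := exists_weightSum_le_const k θ hθ
  rw [weightSum_const] at hle
  have hfin := pow_mul_pow_le hkn hn (p := Real.sin μ ^ 2)
    ⟨sq_nonneg _, Real.sin_sq_le_one μ⟩
  rw [← Real.cos_sq'] at hfin
  calc ‖inner ℂ (productVec a) (dicke n k)‖ ^ 2
      ≤ ((Real.sqrt (n.choose k))⁻¹ *
          (n.choose k * (angleVec μ 1 ^ k * angleVec μ 0 ^ (n - k)))) ^ 2 := by
        gcongr
        exact hbound.trans (by gcongr)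
    _ = n.choose k * ((Real.sin μ ^ 2) ^ k * (Real.cos μ ^ 2) ^ (n - k)) := by
        simp only [angleVec, Matrix.cons_val_zero, Matrix.cons_val_one]
        rw [mul_pow, inv_pow, Real.sq_sqrt hC.le]
        field_simp
        ring
    _ ≤ _ := by unfold dickeOverlap; gcongr

lemma exists_inner_dicke {n k : ℕ} (hkn : k ≤ n) :
    ∃ a : Fin n → EuclideanSpace ℂ (Fin 2), (∀ i, ‖a i‖ = 1) ∧
      ‖inner ℂ (productVec a) (dicke n k)‖ ^ 2 = dickeOverlap n k := by
  have hC : (0 : ℝ) < n.choose k := by exact_mod_cast Nat.choose_pos hkn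
  have hkn' : (k : ℝ) ≤ n := by exact_mod_cast hkn
  have hq0 : (0 : ℝ) ≤ k / n := by positivity
  have hq1 : (0 : ℝ) ≤ 1 - k / n := sub_nonneg.2 (div_le_one_of_le₀ hkn' (by positivity))
  -- The optimal factor puts weight `k / n` on the excited state, so that the expected number of
  -- excitations is `k`.
  set t : Fin 2 → ℝ := ![Real.sqrt (1 - k / n), Real.sqrt (k / n)] with ht
  refine ⟨fun _ => WithLp.toLp 2 fun b => (t b : ℂ), fun i => ?_, ?_⟩
  · rw [EuclideanSpace.norm_eq, Fin.sum_univ_two]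
    simp only [ht, Matrix.cons_val_zero, Matrix.cons_val_one, Complex.norm_real, Real.norm_eq_abs,
      sq_abs, Real.sq_sqrt hq0, Real.sq_sqrt hq1, sub_add_cancel, Real.sqrt_one]
  · have h : inner ℂ (productVec fun _ : Fin n => WithLp.toLp 2 fun b => (t b : ℂ)) (dicke n k) =
        (((Real.sqrt (n.choose k))⁻¹ * weightSum k (fun _ : Fin n => t) : ℝ) : ℂ) := by
      rw [PiLp.inner_apply, weightSum, Finset.mul_sum, Complex.ofReal_sum]
      refine Finset.sum_congr rfl fun x _ => ?_
      simp only [productVec, dicke, RCLike.inner_apply, map_prod]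
      split_ifs <;> simp
    rw [h, Complex.norm_real, Real.norm_eq_abs, sq_abs, weightSum_const, mul_pow, inv_pow,
      Real.sq_sqrt hC.le, dickeOverlap]
    simp only [ht, Matrix.cons_val_zero, Matrix.cons_val_one]
    rw [mul_pow, mul_pow, ← pow_mul, ← pow_mul, mul_comm k 2, mul_comm (n - k) 2, pow_mul, pow_mul,
      Real.sq_sqrt hq0, Real.sq_sqrt hq1]
    field_simp

lemma geometricEntanglement_dicke {n k : ℕ} (hkn : k ≤ n) (hn : 0 < n) :
    geometricEntanglement (dicke n k) = 1 - dickeOverlap n k := by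
  obtain ⟨a, ha, h⟩ := exists_inner_dicke hkn
  unfold geometricEntanglement
  congr 1
  refine IsGreatest.csSup_eq ⟨⟨_, ⟨a, ha, rfl⟩, h⟩, ?_⟩
  rintro _ ⟨_, ⟨b, hb, rfl⟩, rfl⟩
  exact norm_inner_dicke_sq hkn hn b hb

lemma norm_dicke {n k : ℕ} (hkn : k ≤ n) : ‖dicke n k‖ = 1 := by
  have hC : (0 : ℝ) < n.choose k := by exact_mod_cast Nat.choose_pos hkn
  -- With all entries equal to `1`, the weighted sum counts the strings of weight `k`.
  have h := weightSum_const n k (fun _ => 1)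
  simp only [weightSum, Finset.prod_const_one, one_pow, mul_one] at h
  rw [← sq_eq_sq₀ (norm_nonneg _) zero_le_one, EuclideanSpace.norm_sq_eq]
  have : ∀ x : Bits n, ‖dicke n k x‖ ^ 2 = (n.choose k : ℝ)⁻¹ *
      (if (Finset.univ.filter fun i => x i = 1).card = k then 1 else 0) := by
    intro x
    simp only [dicke]
    split_ifs
    · rw [Complex.norm_real, Real.norm_eq_abs, sq_abs, inv_pow, Real.sq_sqrt hC.le, mul_one]
    · simp
  simp_rw [this]
  rw [← Finset.mul_sum, h, one_pow, inv_mul_cancel₀ hC.ne']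

/-! ### Asymptotics of the overlap -/

/-- The limit `k ^ k / (e ^ k k!)` of the maximal overlaps of the Dicke states. -/
noncomputable def poissonPeak (k : ℕ) : ℝ := (k : ℝ) ^ k / (Real.exp k * (k ! : ℝ))

/-- Consecutive terms have ratio `e / (1 + 1/n)^n`, and `(1 + 1/n)^n ≤ e`. -/
lemma monotone_factorial_mul_exp_div_pow :
    Monotone fun n : ℕ => (n ! : ℝ) * Real.exp n / (n : ℝ) ^ n := by
  refine monotone_nat_of_le_succ fun n => ?_
  rcases Nat.eq_zero_or_pos n with rfl | hn
  · simp
  have hn' : (0 : ℝ) < n := by exact_mod_cast hn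
  have h1 : ((n : ℝ) + 1) ^ n ≤ Real.exp 1 * (n : ℝ) ^ n := by
    have h := pow_le_pow_left₀ (by positivity) (Real.add_one_le_exp (1 / (n : ℝ))) n
    rw [← Real.exp_nat_mul, mul_one_div_cancel hn'.ne'] at h
    calc ((n : ℝ) + 1) ^ n = (1 / (n : ℝ) + 1) ^ n * (n : ℝ) ^ n := by
          rw [← mul_pow]; congr 1; field_simp; ring
      _ ≤ _ := by gcongr
  rw [div_le_div_iff₀ (by positivity) (by positivity), Nat.factorial_succ]
  push_cast
  rw [Real.exp_add, pow_succ]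
  calc (n ! : ℝ) * Real.exp n * (((n : ℝ) + 1) ^ n * (n + 1))
      ≤ (n ! : ℝ) * Real.exp n * ((Real.exp 1 * (n : ℝ) ^ n) * (n + 1)) := by gcongr
    _ = _ := by ring

/-- With `m = n - k`, the ratio of the two sides is the quotient of `n! e^n / n^n` by `m! e^m /
m^m`, so monotonicity of that sequence decides. -/
lemma poissonPeak_le_dickeOverlap {n k : ℕ} (hk : 1 ≤ k) (hkn : k ≤ n) :
    poissonPeak k ≤ dickeOverlap n k := by
  obtain ⟨m, rfl⟩ := Nat.exists_eq_add_of_le' hkn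
  have hn : (0 : ℝ) < m + k := by have : (1 : ℝ) ≤ k := by exact_mod_cast hk
                                  positivity
  have hm := monotone_factorial_mul_exp_div_pow (Nat.le_add_right m k)
  simp only at hm
  have hmm : (0 : ℝ) < (m : ℝ) ^ m := by
    rcases Nat.eq_zero_or_pos m with rfl | h
    · simp
    · have : (0 : ℝ) < m := by exact_mod_cast h
      positivity
  have h1 : (1 - (k : ℝ) / (m + k)) = m / (m + k) := by field_simp; ring
  have hch : ((m + k).choose k : ℝ) = ((m + k) ! : ℝ) / ((k ! : ℝ) * (m ! : ℝ)) := by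
    rw [Nat.cast_choose ℝ hkn, Nat.add_sub_cancel]
  unfold poissonPeak dickeOverlap
  rw [hch, Nat.add_sub_cancel]
  push_cast at hm ⊢
  rw [h1, Real.exp_add, div_le_div_iff₀ hmm (by positivity)] at *
  rw [div_pow, div_pow, div_mul_div_comm, ← pow_add, div_mul_div_comm,
    div_le_div_iff₀ (by positivity) (by positivity), add_comm k m]
  have hfin := mul_le_mul_of_nonneg_left hm
    (show 0 ≤ (k : ℝ) ^ k * (k ! : ℝ) * (Real.exp m)⁻¹ by positivity)
  have he := (Real.exp_pos (m : ℝ)).ne'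
  calc _ = (k : ℝ) ^ k * (k ! : ℝ) * (Real.exp m)⁻¹ *
        ((m ! : ℝ) * Real.exp m * ((m : ℝ) + k) ^ (m + k)) := by field_simp
    _ ≤ _ := hfin
    _ = _ := by field_simp

/-- This is the Poisson limit theorem with success probability `k / n`. -/
lemma tendsto_dickeOverlap (k : ℕ) :
    Tendsto (fun n => dickeOverlap n k) atTop (𝓝 (poissonPeak k)) := by
  have h0 : Tendsto (fun n : ℕ => (n : ℝ) * ((k : ℝ) / n)) atTop (𝓝 (k : ℝ)) := by
    refine tendsto_const_nhds.congr' ?_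
    filter_upwards [eventually_ge_atTop 1] with n hn
    have : (0 : ℝ) < n := by exact_mod_cast hn
    field_simp
  convert ProbabilityTheory.tendsto_choose_mul_pow_of_tendsto_mul_atTop k h0 using 1
  · funext n
    unfold dickeOverlap
    ring
  · rw [poissonPeak, Real.exp_neg]
    congr 1
    field_simp

/-! ### Explicit Stirling bounds and the numerical inequalities -/

/-- The increments of `log (stirlingSeq n)` are bounded by a telescoping difference of `1 / (12 n)`;
hence `log (stirlingSeq n) - 1 / (12 n)` increases to its limit `log √π`. Indices start at `1` to
avoid the meaningless value at `0`. -/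
lemma log_stirlingSeq_le {n : ℕ} (hn : 1 ≤ n) :
    Real.log (Stirling.stirlingSeq n) ≤ Real.log (Real.sqrt Real.pi) + 1 / (12 * n) := by
  have hmono : Monotone fun m : ℕ =>
      Real.log (Stirling.stirlingSeq (m + 1)) - 1 / (12 * ((m + 1 : ℕ) : ℝ)) := by
    refine monotone_nat_of_le_succ fun m => ?_
    have h := Stirling.log_stirlingSeq_sdiff_le (m + 1)
    have e : 1 / (12 * ((m + 1 : ℕ) : ℝ) * (((m + 1 : ℕ) : ℝ) + 1)) =
        1 / (12 * ((m + 1 : ℕ) : ℝ)) - 1 / (12 * ((m + 1 + 1 : ℕ) : ℝ)) := by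
      push_cast
      field_simp
      ring
    rw [e] at h
    linarith
  have hlim : Tendsto (fun m : ℕ =>
      Real.log (Stirling.stirlingSeq (m + 1)) - 1 / (12 * ((m + 1 : ℕ) : ℝ))) atTop
      (𝓝 (Real.log (Real.sqrt Real.pi) - 0)) := by
    refine Tendsto.sub ?_ ?_
    · exact ((Real.continuousAt_log (by positivity)).tendsto.comp
        Stirling.tendsto_stirlingSeq_sqrt_pi).comp (tendsto_add_atTop_nat 1)
    · have h : Tendsto (fun m : ℕ => 1 / (12 * (m : ℝ))) atTop (𝓝 0) := by
        have := (tendsto_one_div_atTop_nhds_zero_nat (𝕜 := ℝ)).const_mul (1 / 12)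
        rw [mul_zero] at this
        refine this.congr fun m => ?_
        rw [one_div_mul_one_div]
      exact h.comp (tendsto_add_atTop_nat 1)
  have := hmono.ge_of_tendsto hlim (n - 1)
  rw [Nat.sub_add_cancel hn] at this
  linarith

lemma le_poissonPeak {k : ℕ} (hk : 1 ≤ k) :
    0.3989 * (Real.sqrt k)⁻¹ * (1 - (Real.sqrt k)⁻¹ ^ 2 / 12) ≤ poissonPeak k := by
  have hk' : (0 : ℝ) < k := by exact_mod_cast hk
  have hpos : 0 < Stirling.stirlingSeq k := by
    have := Stirling.stirlingSeq'_pos (k - 1)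
    rwa [Nat.sub_add_cancel hk] at this
  have hle : Stirling.stirlingSeq k ≤ Real.sqrt Real.pi * Real.exp (1 / (12 * k)) := by
    rw [← Real.log_le_log_iff hpos (by positivity), Real.log_mul (by positivity) (by positivity),
      Real.log_exp]
    exact log_stirlingSeq_le hk
  have heq : poissonPeak k = (Stirling.stirlingSeq k * Real.sqrt 2 * Real.sqrt k)⁻¹ := by
    have h2 : Real.exp (k : ℝ) = Real.exp 1 ^ k := by rw [← Real.exp_nat_mul, mul_one]
    rw [poissonPeak, Stirling.stirlingSeq, h2, Real.sqrt_mul zero_le_two, div_pow]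
    field_simp
  have hu : (Real.sqrt k)⁻¹ ^ 2 / 12 = 1 / (12 * k) := by
    rw [inv_pow, Real.sq_sqrt hk'.le]
    field_simp
  have hexp : 1 - 1 / (12 * (k : ℝ)) ≤ (Real.exp (1 / (12 * k)))⁻¹ := by
    rw [← Real.exp_neg]
    linarith [Real.add_one_le_exp (-(1 / (12 * (k : ℝ))))]
  -- The constant `0.3989` is `1 / √(2π)` rounded down.
  have hnum : 0.3989 ≤ (Real.sqrt Real.pi * Real.sqrt 2)⁻¹ := by
    rw [← Real.sqrt_mul Real.pi_pos.le, ← Real.sqrt_inv]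
    refine Real.le_sqrt_of_sq_le ?_
    rw [le_inv_comm₀ (by positivity) (by positivity)]
    have := Real.pi_lt_d4
    norm_num
    linarith
  rw [heq, hu]
  have hk12 : 0 ≤ 1 - 1 / (12 * (k : ℝ)) := by
    have : (1 : ℝ) ≤ k := by exact_mod_cast hk
    rw [sub_nonneg, div_le_one (by positivity)]
    linarith
  calc 0.3989 * (Real.sqrt k)⁻¹ * (1 - 1 / (12 * (k : ℝ)))
      ≤ (Real.sqrt Real.pi * Real.sqrt 2)⁻¹ * (Real.sqrt k)⁻¹ * (Real.exp (1 / (12 * k)))⁻¹ := by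
        gcongr
    _ = (Real.sqrt Real.pi * Real.exp (1 / (12 * k)) * Real.sqrt 2 * Real.sqrt k)⁻¹ := by
        rw [← mul_inv, ← mul_inv]
        congr 1
        ring
    _ ≤ _ := by gcongr

lemma rpow_neg_three_halves (k : ℕ) : (k : ℝ) ^ (-(3 / 2) : ℝ) = (Real.sqrt k)⁻¹ ^ 3 := by
  rw [Real.sqrt_eq_rpow, ← Real.rpow_neg (Nat.cast_nonneg k), ← Real.rpow_mul_natCast
    (Nat.cast_nonneg k)]
  norm_num

lemma inv_sqrt_mem {k : ℕ} (hk : 1 ≤ k) : 0 < (Real.sqrt k)⁻¹ ∧ (Real.sqrt k)⁻¹ ≤ 1 := by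
  have hk' : (1 : ℝ) ≤ k := by exact_mod_cast hk
  have h1 : 1 ≤ Real.sqrt k := Real.one_le_sqrt.2 hk'
  exact ⟨by positivity, inv_le_one_of_one_le₀ h1⟩

lemma four_mul_rpow_sub_le_poissonPeak {k : ℕ} (hk : 1 ≤ k) {h : ℝ} (h0 : 0 ≤ h)
    (hle : h ≤ 0.00099 * (k : ℝ) ^ (-(3 / 2) : ℝ)) :
    4 * h ^ (1 / 3 : ℝ) - 3.4 * h ^ (2 / 3 : ℝ) ≤ poissonPeak k := by
  refine le_trans ?_ (le_poissonPeak hk)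
  obtain ⟨hu0, hu1⟩ := inv_sqrt_mem hk
  rw [rpow_neg_three_halves] at hle
  generalize (Real.sqrt k)⁻¹ = u at *
  set x := h ^ (1 / 3 : ℝ) with hx
  have hx0 : 0 ≤ x := Real.rpow_nonneg h0 _
  have hx2 : h ^ (2 / 3 : ℝ) = x ^ 2 := by
    rw [hx, ← Real.rpow_mul_natCast h0]; norm_num
  have hx3 : x ^ 3 = h := by
    rw [hx, ← Real.rpow_mul_natCast h0]; norm_num
  -- `0.0997` is slightly above the cube root of `0.00099`, yet `4 * 0.0997 = 0.3988` stays below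
  -- `0.3989`.
  have hxu : x ≤ 0.0997 * u := by
    refine le_of_pow_le_pow_left₀ three_ne_zero (by positivity) ?_
    rw [hx3, mul_pow]
    refine hle.trans ?_
    gcongr
    norm_num
  rw [hx2]
  -- The product is `g (0.0997 u) - g x` for `g t = 4 t - 3.4 t²`, which is increasing in this
  -- range. The quadratic term at `0.0997 u` then absorbs the Stirling error, of order `u³ ≤ u²`.
  have h1 : 0 ≤ (0.0997 * u - x) * (4 - 3.4 * (0.0997 * u + x)) :=
    mul_nonneg (by linarith) (by linarith)
  have h2 : u ^ 3 ≤ u ^ 2 := pow_le_pow_of_le_one hu0.le hu1 (by norm_num)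
  nlinarith [sq_nonneg u]

lemma two_mul_lt_poissonPeak {k : ℕ} (hk : 1 ≤ k) {h : ℝ}
    (hle : h ≤ 0.001 * (k : ℝ) ^ (-(3 / 2) : ℝ)) : 2 * h < poissonPeak k := by
  refine lt_of_lt_of_le ?_ (le_poissonPeak hk)
  obtain ⟨hu0, hu1⟩ := inv_sqrt_mem hk
  rw [rpow_neg_three_halves] at hle
  generalize (Real.sqrt k)⁻¹ = u at *
  have h1 : u ^ 3 ≤ u := pow_le_of_le_one hu0.le hu1 three_ne_zero
  linarith

/-! ### Target states with arbitrarily small product overlap -/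

/-- The induction step comes down to `(2j+1)(2j+3) ≤ 4(j+1)²`. -/
lemma centralBinom_sq_le (j : ℕ) :
    (Nat.centralBinom j : ℝ) ^ 2 * (2 * j + 1) ≤ (4 ^ j) ^ 2 := by
  induction j with
  | zero => simp
  | succ j ih =>
    have h : ((j : ℝ) + 1) * Nat.centralBinom (j + 1) = 2 * (2 * j + 1) * Nat.centralBinom j := by
      exact_mod_cast Nat.succ_mul_centralBinom_succ j
    have hj : (0 : ℝ) < (j + 1) ^ 2 := by positivity
    refine le_of_mul_le_mul_left ?_ hj
    push_cast
    calc ((j : ℝ) + 1) ^ 2 * ((Nat.centralBinom (j + 1) : ℝ) ^ 2 * (2 * (j + 1) + 1))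
        = (((j : ℝ) + 1) * Nat.centralBinom (j + 1)) ^ 2 * (2 * j + 3) := by ring
      _ = 4 * ((2 * j + 1) * (2 * j + 3)) *
          ((Nat.centralBinom j : ℝ) ^ 2 * (2 * j + 1)) := by rw [h]; ring
      _ ≤ 4 * ((2 * j + 1) * (2 * j + 3)) * (4 ^ j) ^ 2 := by gcongr
      _ ≤ 4 * (4 * (j + 1) ^ 2) * (4 ^ j) ^ 2 :=
        mul_le_mul_of_nonneg_right (by linarith) (by positivity)
      _ = _ := by ring

lemma exists_dickeOverlap_lt {δ : ℝ} (hδ : 0 < δ) :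
    ∃ n k : ℕ, 0 < n ∧ k ≤ n ∧ dickeOverlap n k < δ := by
  obtain ⟨j, hj⟩ := exists_nat_gt (1 / δ ^ 2)
  have hj0 : (0 : ℝ) < j := lt_trans (by positivity) hj
  have hjn : 0 < j := by exact_mod_cast hj0
  -- Half filling: the overlap is `centralBinom j / 4 ^ j`, of order `1 / √j`.
  refine ⟨2 * j, j, by omega, by omega, ?_⟩
  have e : dickeOverlap (2 * j) j = Nat.centralBinom j / 4 ^ j := by
    have h1 : (j : ℝ) / ((2 * j : ℕ) : ℝ) = 1 / 2 := by push_cast; field_simp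
    rw [dickeOverlap, h1, show 2 * j - j = j by omega, ← mul_pow, Nat.centralBinom,
      show (1 / 2 * (1 - 1 / 2) : ℝ) = 4⁻¹ by norm_num, inv_pow, div_eq_mul_inv]
  rw [e]
  refine lt_of_pow_lt_pow_left₀ 2 hδ.le ?_
  rw [div_pow, div_lt_iff₀ (by positivity)]
  rw [div_lt_iff₀ (by positivity)] at hj
  have h := centralBinom_sq_le j
  have h4 : (0 : ℝ) < (4 ^ j) ^ 2 := by positivity
  have hc : (0 : ℝ) ≤ (Nat.centralBinom j : ℝ) ^ 2 := sq_nonneg _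
  refine lt_of_mul_lt_mul_right ?_ (show (0 : ℝ) ≤ 2 * j + 1 by positivity)
  refine h.trans_lt ?_
  nlinarith [sq_nonneg δ, mul_pos h4 hj0]

/-! ### Entanglement of the family of Dicke states -/

lemma tendsto_geometricEntanglement_dicke (k : ℕ) :
    Tendsto (fun n : ℕ => geometricEntanglement (dicke n k)) atTop (𝓝 (1 - poissonPeak k)) := by
  refine ((tendsto_dickeOverlap k).const_sub 1).congr' ?_
  filter_upwards [eventually_ge_atTop k, eventually_ge_atTop 1] with n hn h1
  exact (geometricEntanglement_dicke hn h1).symm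

lemma familyEntanglement_dickeFamily {k : ℕ} (hk : 1 ≤ k) :
    familyEntanglement (dickeFamily k) = 1 - poissonPeak k := by
  refine IsLUB.csSup_eq ⟨?_, fun b hb => ?_⟩ ⟨_, _, ⟨k, le_rfl, rfl⟩, rfl⟩
  · rintro _ ⟨_, ⟨n, hn, rfl⟩, rfl⟩
    simp only
    rw [geometricEntanglement_dicke hn (by omega)]
    linarith [poissonPeak_le_dickeOverlap hk hn]
  · refine le_of_tendsto (tendsto_geometricEntanglement_dicke k) ?_
    filter_upwards [eventually_ge_atTop k] with n hn
    exact hb ⟨_, ⟨n, hn, rfl⟩, rfl⟩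

/-! ### LOCC protocols on pure states -/

lemma localOp_eq_kronecker {n : ℕ} (i : Fin n) (K : Matrix (Fin 2) (Fin 2) ℂ) :
    localOp i K = (Matrix.kronecker K (1 : Matrix ({j // j ≠ i} → Fin 2) _ ℂ)).submatrix
      (Equiv.funSplitAt i (Fin 2)) (Equiv.funSplitAt i (Fin 2)) := by
  ext x y
  simp [localOp, Matrix.kronecker, Matrix.one_apply, Equiv.funSplitAt, Equiv.piSplitAt, funext_iff]

lemma sum_localOp_conjTranspose_mul {n r : ℕ} (i : Fin n) (K : Fin r → Matrix (Fin 2) (Fin 2) ℂ)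
    (hK : ∑ x, (K x).conjTranspose * K x = 1) :
    ∑ x, (localOp i (K x)).conjTranspose * localOp i (K x) = 1 := by
  have h : ∀ x, (localOp i (K x)).conjTranspose * localOp i (K x) =
      localOp i ((K x).conjTranspose * K x) := by
    intro x
    simp only [localOp_eq_kronecker, Matrix.conjTranspose_submatrix, Matrix.submatrix_mul_equiv,
      Matrix.kronecker]
    rw [Matrix.conjTranspose_kronecker, ← Matrix.mul_kronecker_mul]
    simp
  simp_rw [h]
  have hs : ∑ x, localOp i ((K x).conjTranspose * K x) =
      localOp i (∑ x, (K x).conjTranspose * K x) := by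
    ext y z
    simp only [Matrix.sum_apply, localOp, Matrix.of_apply]
    split_ifs <;> simp
  rw [hs, hK, localOp_eq_kronecker]
  simp [Matrix.kronecker]

/-- The operator `M` applied to the vector `ψ`. -/
noncomputable def applyOp {m : Type*} [Fintype m] (M : Matrix m m ℂ) (ψ : EuclideanSpace ℂ m) :
    EuclideanSpace ℂ m :=
  WithLp.toLp 2 (M.mulVec ψ.ofLp)

lemma ofReal_norm_sq_eq_dotProduct {m : Type*} [Fintype m] (ψ : EuclideanSpace ℂ m) :
    ((‖ψ‖ ^ 2 : ℝ) : ℂ) = star ψ.ofLp ⬝ᵥ ψ.ofLp := by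
  rw [EuclideanSpace.norm_sq_eq, dotProduct, Complex.ofReal_sum]
  refine Finset.sum_congr rfl fun x _ => ?_
  rw [Pi.star_apply, RCLike.star_def, RCLike.conj_mul]
  simp

lemma inner_eq_star_dotProduct {m : Type*} [Fintype m] (ψ χ : EuclideanSpace ℂ m) :
    inner ℂ ψ χ = star ψ.ofLp ⬝ᵥ χ.ofLp := by
  rw [PiLp.inner_apply, dotProduct]
  exact Finset.sum_congr rfl fun x _ => by simp [mul_comm]

lemma sum_norm_sq_applyOp {m ι : Type*} [Fintype m] [DecidableEq m] [Fintype ι]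
    (M : ι → Matrix m m ℂ) (hM : ∑ x, (M x).conjTranspose * M x = 1) (ψ : EuclideanSpace ℂ m) :
    ∑ x, ‖applyOp (M x) ψ‖ ^ 2 = ‖ψ‖ ^ 2 := by
  have h : ∀ x, ((‖applyOp (M x) ψ‖ ^ 2 : ℝ) : ℂ) =
      star ψ.ofLp ⬝ᵥ ((M x).conjTranspose * M x).mulVec ψ.ofLp := by
    intro x
    rw [ofReal_norm_sq_eq_dotProduct, applyOp, Matrix.star_mulVec, ← Matrix.dotProduct_mulVec,
      Matrix.mulVec_mulVec]
  have key : ((∑ x, ‖applyOp (M x) ψ‖ ^ 2 : ℝ) : ℂ) = ((‖ψ‖ ^ 2 : ℝ) : ℂ) := by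
    rw [Complex.ofReal_sum]
    simp_rw [h]
    rw [← dotProduct_sum, ← Matrix.sum_mulVec, hM, Matrix.one_mulVec, ofReal_norm_sq_eq_dotProduct]
  exact_mod_cast key

lemma pureDensity_eq_vecMulVec {n : ℕ} (ψ : QubitSpace n) :
    pureDensity ψ = Matrix.vecMulVec ψ.ofLp (star ψ.ofLp) := rfl

lemma pureDensity_applyOp {n : ℕ} (M : QubitOp n) (ψ : QubitSpace n) :
    pureDensity (applyOp M ψ) = M * pureDensity ψ * M.conjTranspose := by
  rw [pureDensity_eq_vecMulVec, pureDensity_eq_vecMulVec, Matrix.mul_vecMulVec,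
    Matrix.vecMulVec_mul, applyOp, Matrix.star_mulVec]

lemma trace_pureDensity {n : ℕ} (ψ : QubitSpace n) :
    (pureDensity ψ).trace = ((‖ψ‖ ^ 2 : ℝ) : ℂ) := by
  rw [pureDensity_eq_vecMulVec, Matrix.trace_vecMulVec, ofReal_norm_sq_eq_dotProduct,
    dotProduct_comm]

/-- The one-qubit vector obtained by contracting `ψ` with the product of the `a j`, `j ≠ i`. -/
noncomputable def partialInner {n : ℕ} (i : Fin n) (a : Fin n → EuclideanSpace ℂ (Fin 2)) (ψ : QubitSpace n) :
    EuclideanSpace ℂ (Fin 2) :=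
  WithLp.toLp 2 fun b => ∑ y : {j // j ≠ i} → Fin 2,
    (∏ j : {j // j ≠ i}, star (a j (y j))) * ψ ((Equiv.funSplitAt i (Fin 2)).symm (b, y))

lemma inner_productVec {n : ℕ} (i : Fin n) (a : Fin n → EuclideanSpace ℂ (Fin 2))
    (ψ : QubitSpace n) :
    inner ℂ (productVec a) ψ = inner ℂ (a i) (partialInner i a ψ) := by
  rw [PiLp.inner_apply, PiLp.inner_apply, ← (Equiv.funSplitAt i (Fin 2)).symm.sum_comp,
    Fintype.sum_prod_type]
  refine Finset.sum_congr rfl fun b _ => ?_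
  simp only [partialInner, RCLike.inner_apply, Finset.sum_mul]
  refine Finset.sum_congr rfl fun y _ => ?_
  have h : productVec a ((Equiv.funSplitAt i (Fin 2)).symm (b, y)) =
      a i b * ∏ j : {j // j ≠ i}, a j (y j) := by
    simp only [productVec]
    rw [Fintype.prod_eq_mul_prod_subtype_ne _ i]
    congr 1
    · simp [Equiv.funSplitAt, Equiv.piSplitAt]
    · refine Finset.prod_congr rfl fun j _ => ?_
      simp [Equiv.funSplitAt, Equiv.piSplitAt, j.2]
  rw [h, map_mul, map_prod]
  simp only [RCLike.star_def]
  ring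

lemma partialInner_applyOp_localOp {n : ℕ} (i : Fin n) (K : Matrix (Fin 2) (Fin 2) ℂ)
    (a : Fin n → EuclideanSpace ℂ (Fin 2)) (ψ : QubitSpace n) :
    partialInner i a (applyOp (localOp i K) ψ) = applyOp K (partialInner i a ψ) := by
  have h : ∀ b y, applyOp (localOp i K) ψ ((Equiv.funSplitAt i (Fin 2)).symm (b, y)) =
      ∑ c, K b c * ψ ((Equiv.funSplitAt i (Fin 2)).symm (c, y)) := by
    intro b y
    simp only [applyOp, Matrix.mulVec, dotProduct]
    rw [← (Equiv.funSplitAt i (Fin 2)).symm.sum_comp, Fintype.sum_prod_type]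
    refine Finset.sum_congr rfl fun c _ => ?_
    rw [Finset.sum_eq_single y]
    · simp [localOp_eq_kronecker, Matrix.kronecker]
    · intro z _ hz
      simp [localOp_eq_kronecker, Matrix.kronecker, hz.symm]
    · simp
  ext b
  simp only [partialInner, h]
  simp only [applyOp, Matrix.mulVec, dotProduct, Finset.mul_sum]
  rw [Finset.sum_comm]
  exact Finset.sum_congr rfl fun c _ => Finset.sum_congr rfl fun y _ => by ring

lemma partialInner_update {n : ℕ} (i : Fin n) (a : Fin n → EuclideanSpace ℂ (Fin 2))
    (u : EuclideanSpace ℂ (Fin 2)) (ψ : QubitSpace n) :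
    partialInner i (Function.update a i u) ψ = partialInner i a ψ := by
  have h : ∀ j : {j // j ≠ i}, Function.update a i u j = a j := fun j =>
    Function.update_of_ne j.2 _ _
  simp only [partialInner, h]

lemma exists_unit_norm_inner_sq_eq (w : EuclideanSpace ℂ (Fin 2)) :
    ∃ u : EuclideanSpace ℂ (Fin 2), ‖u‖ = 1 ∧ ‖inner ℂ u w‖ ^ 2 = ‖w‖ ^ 2 := by
  by_cases hw : w = 0
  · exact ⟨EuclideanSpace.single 0 1, by simp, by simp [hw]⟩
  · have h : ‖w‖ ≠ 0 := norm_ne_zero_iff.2 hw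
    refine ⟨((‖w‖⁻¹ : ℝ) : ℂ) • w, ?_, ?_⟩
    · rw [norm_smul, Complex.norm_real, norm_inv, norm_norm, inv_mul_cancel₀ h]
    · rw [inner_smul_left, norm_mul, inner_self_eq_norm_sq_to_K]
      simp only [RCLike.norm_conj, Complex.norm_real, norm_inv, norm_norm, norm_pow]
      simp only [Complex.coe_algebraMap, Complex.norm_real, norm_norm]
      field_simp

/-- A deterministic LOCC protocol turns a pure state into an ensemble of pure states whose average
maximal product overlap is at least that of the initial state. -/
lemma IsLOCC.exists_ensemble {n : ℕ} {Λ : QubitOp n → QubitOp n} (hΛ : IsLOCC Λ)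
    (ψ : QubitSpace n) (a : Fin n → EuclideanSpace ℂ (Fin 2)) (ha : ∀ i, ‖a i‖ = 1) :
    ∃ (ι : Type) (_ : Fintype ι) (ω : ι → QubitSpace n)
      (b : ι → Fin n → EuclideanSpace ℂ (Fin 2)), (∀ j i, ‖b j i‖ = 1) ∧
      Λ (pureDensity ψ) = ∑ j, pureDensity (ω j) ∧ ∑ j, ‖ω j‖ ^ 2 = ‖ψ‖ ^ 2 ∧
      ‖inner ℂ (productVec a) ψ‖ ^ 2 ≤ ∑ j, ‖inner ℂ (productVec (b j)) (ω j)‖ ^ 2 := by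
  induction hΛ generalizing ψ a with
  | done => exact ⟨Unit, inferInstance, fun _ => ψ, fun _ => a, fun _ => ha, by simp⟩
  | step i r K hK Λ hΛ ih =>
    -- After outcome `x`, the factor at party `i` is realigned with `K x` applied to the contracted
    -- vector `w`, so the overlap becomes `‖K x w‖²`. By completeness of the Kraus operators these
    -- sum to `‖w‖²`, which dominates the initial overlap. The ensemble vectors stay unnormalized
    -- and carry the outcome probabilities.
    choose u hu hinner using fun x =>
      exists_unit_norm_inner_sq_eq (applyOp (K x) (partialInner i a ψ))
    have hupd : ∀ x j, ‖Function.update a i (u x) j‖ = 1 := by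
      intro x j
      by_cases hj : j = i
      · subst hj; simpa using hu x
      · simpa [hj] using ha j
    choose ι inst ω b hb hsum hnorm hle using fun x =>
      ih x (applyOp (localOp i (K x)) ψ) (Function.update a i (u x)) (hupd x)
    refine ⟨Σ x, ι x, inferInstance, fun p => ω p.1 p.2, fun p => b p.1 p.2,
      fun p => hb p.1 p.2, ?_, ?_, ?_⟩
    · rw [Fintype.sum_sigma]
      exact Finset.sum_congr rfl fun x _ => by rw [← pureDensity_applyOp, hsum]
    · rw [Fintype.sum_sigma, ← sum_norm_sq_applyOp _ (sum_localOp_conjTranspose_mul i K hK) ψ]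
      exact Finset.sum_congr rfl fun x _ => hnorm x
    · rw [Fintype.sum_sigma]
      calc ‖inner ℂ (productVec a) ψ‖ ^ 2
          ≤ ‖partialInner i a ψ‖ ^ 2 := by
            rw [inner_productVec i]
            gcongr
            exact (norm_inner_le_norm _ _).trans_eq (by rw [ha, one_mul])
        _ = ∑ x, ‖applyOp (K x) (partialInner i a ψ)‖ ^ 2 := (sum_norm_sq_applyOp K hK _).symm
        _ ≤ _ := by
            refine Finset.sum_le_sum fun x _ => le_trans (le_of_eq ?_) (hle x)
            rw [inner_productVec i, partialInner_update, partialInner_applyOp_localOp,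
              Function.update_self, hinner]

/-! ### Fidelity with a pure state -/

lemma posSemidef_pureDensity {n : ℕ} (ψ : QubitSpace n) : (pureDensity ψ).PosSemidef :=
  Matrix.posSemidef_vecMulVec_self_star _

lemma sqrt_pureDensity {n : ℕ} (w : QubitSpace n) :
    CFC.sqrt (pureDensity w) = ‖w‖⁻¹ • pureDensity w := by
  refine CFC.sqrt_unique ?_ ?_
  · by_cases hw : w = 0
    · subst hw
      simp [pureDensity_eq_vecMulVec]
    · have h : (‖w‖ : ℂ) ≠ 0 := by exact_mod_cast norm_ne_zero_iff.2 hw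
      have hd := ofReal_norm_sq_eq_dotProduct w
      rw [smul_mul_smul_comm, pureDensity_eq_vecMulVec, Matrix.vecMulVec_mul_vecMulVec, ← hd]
      ext x y
      simp only [Matrix.smul_apply, Matrix.vecMulVec_apply, Pi.smul_apply, smul_eq_mul,
        Complex.real_smul]
      push_cast
      field_simp
  · rw [Matrix.nonneg_iff_posSemidef]
    exact (posSemidef_pureDensity w).smul (by positivity)

/-- Since `√ρ |χ⟩⟨χ| √ρ` is the rank-one operator of `√ρ χ`, its square root has trace `‖√ρ χ‖`. The
fidelity is therefore `⟨χ|ρ|χ⟩`, which is linear in the ensemble. -/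
lemma fidelity_sum_pureDensity {n : ℕ} {ι : Type*} [Fintype ι] (ω : ι → QubitSpace n)
    (χ : QubitSpace n) :
    fidelity (∑ j, pureDensity (ω j)) (pureDensity χ) = ∑ j, ‖inner ℂ χ (ω j)‖ ^ 2 := by
  set ρ := ∑ j, pureDensity (ω j) with hρ
  have hpos : ρ.PosSemidef := Matrix.posSemidef_sum _ fun j _ => posSemidef_pureDensity (ω j)
  have hS : (CFC.sqrt ρ).conjTranspose = CFC.sqrt ρ :=
    (Matrix.nonneg_iff_posSemidef.1 (CFC.sqrt_nonneg ρ)).1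
  have hSS : CFC.sqrt ρ * CFC.sqrt ρ = ρ :=
    CFC.sqrt_mul_sqrt_self ρ (Matrix.nonneg_iff_posSemidef.2 hpos)
  have h1 : CFC.sqrt ρ * pureDensity χ * CFC.sqrt ρ = pureDensity (applyOp (CFC.sqrt ρ) χ) := by
    rw [pureDensity_applyOp, hS]
  have h2 : fidelity ρ (pureDensity χ) = ‖applyOp (CFC.sqrt ρ) χ‖ ^ 2 := by
    rw [fidelity, h1, sqrt_pureDensity, Matrix.trace_smul, trace_pureDensity, Complex.real_smul,
      ← Complex.ofReal_mul, Complex.ofReal_re]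
    congr 1
    by_cases h : ‖applyOp (CFC.sqrt ρ) χ‖ = 0
    · simp [h]
    · field_simp
  rw [h2]
  have key : ((‖applyOp (CFC.sqrt ρ) χ‖ ^ 2 : ℝ) : ℂ) = ((∑ j, ‖inner ℂ χ (ω j)‖ ^ 2 : ℝ) : ℂ) := by
    rw [ofReal_norm_sq_eq_dotProduct, applyOp, Matrix.star_mulVec, ← Matrix.dotProduct_mulVec,
      Matrix.mulVec_mulVec, hS, hSS, hρ, Matrix.sum_mulVec, dotProduct_sum, Complex.ofReal_sum]
    refine Finset.sum_congr rfl fun j _ => ?_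
    rw [pureDensity_eq_vecMulVec, Matrix.vecMulVec_mulVec, Complex.ofReal_pow,
      ← Complex.mul_conj', inner_conj_symm, inner_eq_star_dotProduct, inner_eq_star_dotProduct,
      dotProduct_smul, op_smul_eq_mul]
  exact_mod_cast key

/-! ### Padded states -/

lemma sum_ite_zero_off_range {m n : ℕ} {M : Type*} [AddCommMonoid M] (f : Fin m ↪ Fin n)
    (G : Bits n → M) [DecidablePred fun x : Bits n => ∀ j, j ∉ Set.range f → x j = 0] :
    (∑ x : Bits n, if ∀ j, j ∉ Set.range f → x j = 0 then G x else 0) =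
      ∑ y : Bits m, G (Function.extend f y 0) := by
  rw [← Finset.sum_filter]
  refine Finset.sum_nbij' (fun x => x ∘ f) (fun y => Function.extend f y 0) ?_ ?_ ?_ ?_ ?_
  · simp
  · intro y _
    simp only [Finset.mem_filter, Finset.mem_univ, true_and]
    intro j hj
    rw [Function.extend_apply' _ _ _ hj, Pi.zero_apply]
  · intro x hx
    simp only [Finset.mem_filter, Finset.mem_univ, true_and] at hx
    funext j
    by_cases hj : j ∈ Set.range f
    · obtain ⟨i, rfl⟩ := hj
      rw [f.injective.extend_apply, Function.comp]
    · rw [Function.extend_apply' _ _ _ hj, Pi.zero_apply, hx j hj]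
  · intro y _
    exact Function.extend_comp f.injective _ _
  · intro x hx
    simp only [Finset.mem_filter, Finset.mem_univ, true_and] at hx
    congr 1
    funext j
    by_cases hj : j ∈ Set.range f
    · obtain ⟨i, rfl⟩ := hj
      rw [f.injective.extend_apply, Function.comp]
    · rw [Function.extend_apply' _ _ _ hj, Pi.zero_apply, hx j hj]

lemma norm_padZero {m n : ℕ} (f : Fin m ↪ Fin n) (χ : QubitSpace m) : ‖padZero f χ‖ = ‖χ‖ := by
  classical
  rw [← sq_eq_sq₀ (norm_nonneg _) (norm_nonneg _), EuclideanSpace.norm_sq_eq,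
    EuclideanSpace.norm_sq_eq]
  have h := sum_ite_zero_off_range f fun x => ‖χ fun i => x (f i)‖ ^ 2
  simp only [f.injective.extend_apply] at h
  rw [← h]
  refine Finset.sum_congr rfl fun x _ => ?_
  simp only [padZero]
  split_ifs <;> simp

/-- The overlap factorizes, and each padding qubit contributes an amplitude `a j 0` of modulus at
most `1`. -/
lemma norm_inner_padZero_le {m n : ℕ} (f : Fin m ↪ Fin n) (χ : QubitSpace m)
    (a : Fin n → EuclideanSpace ℂ (Fin 2)) (ha : ∀ i, ‖a i‖ = 1) :
    ‖inner ℂ (productVec a) (padZero f χ)‖ ≤ ‖inner ℂ (productVec fun i => a (f i)) χ‖ := by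
  classical
  have h := sum_ite_zero_off_range f fun x => (χ fun i => x (f i)) * star (∏ i, a i (x i))
  simp only [f.injective.extend_apply] at h
  have hprod : ∀ y : Bits m, ∏ j, a j (Function.extend f y 0 j) =
      (∏ i, a (f i) (y i)) * ∏ j ∈ (Finset.univ.map f)ᶜ, a j 0 := by
    intro y
    rw [← Finset.prod_mul_prod_compl (Finset.univ.map f), Finset.prod_map]
    congr 1
    · simp only [f.injective.extend_apply]
    · refine Finset.prod_congr rfl fun j hj => ?_
      rw [Function.extend_apply', Pi.zero_apply]
      simpa using hj
  have heq : inner ℂ (productVec a) (padZero f χ) =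
      inner ℂ (productVec fun i => a (f i)) χ * star (∏ j ∈ (Finset.univ.map f)ᶜ, a j 0) := by
    rw [PiLp.inner_apply, PiLp.inner_apply, Finset.sum_mul]
    refine Eq.trans ?_ (h.trans ?_)
    · refine Finset.sum_congr rfl fun x _ => ?_
      simp only [padZero, productVec, RCLike.inner_apply, RCLike.star_def]
      split_ifs <;> simp
    · refine Finset.sum_congr rfl fun y _ => ?_
      rw [hprod, star_mul']
      simp only [productVec, RCLike.inner_apply, RCLike.star_def]
      ring
  rw [heq, norm_mul, norm_star, norm_prod]
  refine mul_le_of_le_one_right (norm_nonneg _) (Finset.prod_le_one (fun _ _ => norm_nonneg _) ?_)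
  exact fun j _ => (PiLp.norm_apply_le (a j) 0).trans_eq (ha j)

lemma norm_productVec {n : ℕ} (a : Fin n → EuclideanSpace ℂ (Fin 2)) (ha : ∀ i, ‖a i‖ = 1) :
    ‖productVec a‖ = 1 := by
  rw [← sq_eq_sq₀ (norm_nonneg _) zero_le_one, EuclideanSpace.norm_sq_eq]
  simp only [productVec, norm_prod, ← Finset.prod_pow]
  have h := Finset.prod_univ_sum (fun _ : Fin n => (Finset.univ : Finset (Fin 2)))
    fun i b => ‖a i b‖ ^ 2
  rw [Fintype.piFinset_univ] at h
  rw [← h, one_pow]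
  refine Finset.prod_eq_one fun i _ => ?_
  rw [← EuclideanSpace.norm_sq_eq, ha, one_pow]

/-! ### Non-universality -/

/-- Split `v` into its component along `χ` and an orthogonal remainder, then use `(x + y)² ≤ 2x² +
2y²` and Pythagoras. -/
lemma norm_inner_sq_le {E : Type*} [NormedAddCommGroup E] [InnerProductSpace ℂ E] {l χ v : E}
    {δ : ℝ} (hl : ‖l‖ = 1) (hχ : ‖χ‖ = 1) (hδ : ‖inner ℂ l χ‖ ^ 2 ≤ δ) :
    ‖inner ℂ l v‖ ^ 2 ≤ 2 * δ * ‖inner ℂ χ v‖ ^ 2 + 2 * (‖v‖ ^ 2 - ‖inner ℂ χ v‖ ^ 2) := by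
  set c : ℂ := inner ℂ χ v with hc
  have hperp : inner ℂ (c • χ) (v - c • χ) = 0 := by
    rw [inner_smul_left, inner_sub_right, inner_smul_right, inner_self_eq_norm_sq_to_K, hχ]
    simp [hc]
  have hpy := norm_add_sq_eq_norm_sq_add_norm_sq_of_inner_eq_zero _ _ hperp
  rw [add_sub_cancel, norm_smul, hχ, mul_one] at hpy
  have hr : ‖inner ℂ l (v - c • χ)‖ ≤ ‖v - c • χ‖ :=
    (norm_inner_le_norm _ _).trans_eq (by rw [hl, one_mul])
  have htri : ‖inner ℂ l v‖ ≤ ‖c‖ * ‖inner ℂ l χ‖ + ‖v - c • χ‖ := by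
    have e : inner ℂ l v = c * inner ℂ l χ + inner ℂ l (v - c • χ) := by
      rw [inner_sub_right, inner_smul_right]; ring
    rw [e, ← norm_mul]
    exact (norm_add_le _ _).trans (by gcongr)
  calc ‖inner ℂ l v‖ ^ 2 ≤ (‖c‖ * ‖inner ℂ l χ‖ + ‖v - c • χ‖) ^ 2 := by gcongr
    _ ≤ 2 * (‖c‖ * ‖inner ℂ l χ‖) ^ 2 + 2 * ‖v - c • χ‖ ^ 2 := by
        linarith [add_sq_le (a := ‖c‖ * ‖inner ℂ l χ‖) (b := ‖v - c • χ‖)]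
    _ = 2 * ‖inner ℂ l χ‖ ^ 2 * ‖c‖ ^ 2 + 2 * (‖v‖ ^ 2 - ‖c‖ ^ 2) := by
        rw [sq ‖v‖, hpy]; ring
    _ ≤ _ := by gcongr

/-- If every product overlap with `χ` is small, then LOCC from a state with a product overlap `c`
reaches `χ` (padded with zeros) only up to an infidelity of about `c / 2`. -/
lemma IsLOCC.overlap_le {m n : ℕ} {Λ : QubitOp n → QubitOp n} (hΛ : IsLOCC Λ)
    {ψ : QubitSpace n} (hψ : ‖ψ‖ = 1) {χ : QubitSpace m} (hχ : ‖χ‖ = 1) (f : Fin m ↪ Fin n) {δ : ℝ}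
    (hδ : ∀ a : Fin m → EuclideanSpace ℂ (Fin 2), (∀ i, ‖a i‖ = 1) →
      ‖inner ℂ (productVec a) χ‖ ^ 2 ≤ δ)
    (hδ0 : 0 ≤ δ) (a : Fin n → EuclideanSpace ℂ (Fin 2)) (ha : ∀ i, ‖a i‖ = 1) :
    IsDensity (Λ (pureDensity ψ)) ∧
    ‖inner ℂ (productVec a) ψ‖ ^ 2 ≤
      2 * δ + 2 * (1 - fidelity (Λ (pureDensity ψ)) (pureDensity (padZero f χ))) := by
  obtain ⟨ι, _, ω, b, hb, hsum, hnorm, hle⟩ := hΛ.exists_ensemble ψ a ha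
  have hpad : ‖padZero f χ‖ = 1 := by rw [norm_padZero, hχ]
  rw [hψ, one_pow] at hnorm
  rw [hsum, fidelity_sum_pureDensity]
  refine ⟨⟨Matrix.posSemidef_sum _ fun j _ => posSemidef_pureDensity (ω j), ?_⟩, ?_⟩
  · rw [Matrix.trace_sum]
    simp_rw [trace_pureDensity]
    rw [← Complex.ofReal_sum, hnorm, Complex.ofReal_one]
  have hF : ∑ j, ‖inner ℂ (padZero f χ) (ω j)‖ ^ 2 ≤ 1 := by
    rw [← hnorm]
    refine Finset.sum_le_sum fun j _ => ?_
    gcongr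
    exact (norm_inner_le_norm _ _).trans_eq (by rw [hpad, one_mul])
  calc ‖inner ℂ (productVec a) ψ‖ ^ 2
      ≤ ∑ j, ‖inner ℂ (productVec (b j)) (ω j)‖ ^ 2 := hle
    _ ≤ ∑ j, (2 * δ * ‖inner ℂ (padZero f χ) (ω j)‖ ^ 2 +
          2 * (‖ω j‖ ^ 2 - ‖inner ℂ (padZero f χ) (ω j)‖ ^ 2)) := by
        refine Finset.sum_le_sum fun j _ =>
          norm_inner_sq_le (norm_productVec _ (hb j)) hpad (le_trans ?_ (hδ _ fun i => hb j (f i)))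
        gcongr
        exact norm_inner_padZero_le f χ (b j) (hb j)
    _ = 2 * δ * ∑ j, ‖inner ℂ (padZero f χ) (ω j)‖ ^ 2 +
          2 * (1 - ∑ j, ‖inner ℂ (padZero f χ) (ω j)‖ ^ 2) := by
        rw [Finset.sum_add_distrib, ← Finset.mul_sum, ← Finset.mul_sum, Finset.sum_sub_distrib,
          hnorm]
    _ ≤ _ := by linarith [mul_le_of_le_one_right (show 0 ≤ 2 * δ by positivity) hF]

lemma not_isApproxUniversal_dickeFamily {k : ℕ} (hk : 1 ≤ k)
    {D : ∀ n : ℕ, QubitOp n → QubitOp n → ℝ} {η : ℝ → ℝ} {ε₀ : ℝ}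
    (hD : StrictlyRelatedToFidelity D η ε₀) {ε : ℝ} (hε : ε ∈ Icc 0 ε₀)
    (hη : 2 * η ε < poissonPeak k) : ¬ IsApproxUniversal D ε (dickeFamily k) := by
  intro huniv
  -- The threshold makes `2δ + 2η < poissonPeak k`, contradicting the LOCC bound whatever the size
  -- `n` of the resource.
  obtain ⟨m, l, hm, hlm, hδ⟩ :=
    exists_dickeOverlap_lt (show 0 < (poissonPeak k - 2 * η ε) / 2 by linarith)
  obtain ⟨_, _, f, Λ, ⟨n, hkn, heq⟩, hΛ, hle⟩ := huniv m (dicke m l) (norm_dicke hlm)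
  cases heq
  obtain ⟨a, ha, hinner⟩ := exists_inner_dicke hkn
  have hbound : ∀ b : Fin m → EuclideanSpace ℂ (Fin 2), (∀ i, ‖b i‖ = 1) →
      ‖inner ℂ (productVec b) (dicke m l)‖ ^ 2 ≤ dickeOverlap m l := norm_inner_dicke_sq hlm hm
  have h0 : 0 ≤ dickeOverlap m l := by
    obtain ⟨b, _, h⟩ := exists_inner_dicke hlm
    rw [← h]
    positivity
  obtain ⟨hdens, h⟩ := hΛ.overlap_le (norm_dicke hkn) (norm_dicke hlm) f hbound h0 a ha
  have hdens' : IsDensity (pureDensity (padZero f (dicke m l))) :=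
    ⟨posSemidef_pureDensity _, by rw [trace_pureDensity, norm_padZero, norm_dicke hlm]; simp⟩
  have hF := hD.le_fidelity ε hε _ _ _ hdens hdens' hle
  have hpeak := poissonPeak_le_dickeOverlap hk hkn
  rw [hinner] at h
  linarith

theorem mainTheorem1 (k : ℕ) (hk : 1 ≤ k) :
    (∀ (D : ∀ n : ℕ, QubitOp n → QubitOp n → ℝ) (η : ℝ → ℝ) (ε₀ : ℝ),
      StrictlyRelatedToFidelity D η ε₀ →
      ∀ ε ∈ Icc 0 ε₀, η ε ≤ 0.001 * (k : ℝ) ^ (-(3 / 2) : ℝ) →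
        ¬ IsApproxUniversal D ε (dickeFamily k)) ∧
    familyEntanglement (dickeFamily k) = 1 - (k : ℝ) ^ k / (Real.exp k * (k ! : ℝ)) ∧
    Tendsto (fun n : ℕ => geometricEntanglement (dicke n k)) atTop
      (𝓝 (1 - (k : ℝ) ^ k / (Real.exp k * (k ! : ℝ)))) ∧
    (∀ h : ℝ, 0 ≤ h → h ≤ 0.00099 * (k : ℝ) ^ (-(3 / 2) : ℝ) →
      ¬ (1 - 4 * h ^ (1 / 3 : ℝ) + 3.4 * h ^ (2 / 3 : ℝ) <
        familyEntanglement (dickeFamily k))) := by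
  refine ⟨fun D η ε₀ hD ε hε hη =>
      not_isApproxUniversal_dickeFamily hk hD hε (two_mul_lt_poissonPeak hk hη),
    familyEntanglement_dickeFamily hk, tendsto_geometricEntanglement_dicke k, fun h h0 hle => ?_⟩
  rw [familyEntanglement_dickeFamily hk, not_lt]
  linarith [four_mul_rpow_sub_le_poissonPeak hk h0 hle]
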